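/- Let $n\ge 0$, and let $T_1$ and $T_2$ be two triangulations of a convex $(n+3)$-gon (without new vertices), each identified with its set of $n$ diagonals. For a triangulation $T$ of the $(n+3)$-gon and a basis $(\alpha_\delta)_{\delta\in T}$ of an $n$-dimensional real vector space $V$, indexed by the diagonals of $T$, associate to each diagonal $d$ of the polygon the vector $v_d=-\alpha_d$ if $d\in T$, and $v_d=\sum_{\delta\in T,\ \delta \text{ crosses } d}\alpha_\delta$ if $d\notin T$. The Santos fan $\mathcal F_T$ is the simplicial fan in $V$ whose maximal cones are the cones $\mathbb R_{\ge 0}\{v_d : d\in T'\}$, for all triangulations $T'$ of the $(n+3)$-gon; its cones are $\mathbb R_{\ge 0}\{v_d : d\in S\}$ for all non-crossing sets $S$ of diagonals. A Santos associahedron $\mathrm{Ass}^{II}(T)$ is a polytope whose normal fan is $\mathcal F_T$ (for some choice of the basis); by abuse of notation, $\mathrm{Ass}^{II}(T)$ also denotes the fan $\mathcal F_T$ itself. Two fans are linearly isomorphic if there is a linear isomorphism of the ambient spaces that maps the cones of one to the cones of the other, and two polytopes are normally isomorphic if their normal fans are linearly isomorphic. Then $\mathrm{Ass}^{II}(T_1)$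 and $\mathrm{Ass}^{II}(T_2)$ are normally isomorphic if and only if $T_1$ and $T_2$ are equivalent under a rotation or reflection of the $(n+3)$-gon. That is: (i) for all choices of the bases, the fans $\mathcal F_{T_1}$ and $\mathcal F_{T_2}$ are linearly isomorphic if and only if some rotation or reflection of the $(n+3)$-gon maps $T_1$ to $T_2$; and (ii) whenever $P_1$ and $P_2$ are polytopes that are Santos associahedra for $T_1$ and $T_2$, they are normally isomorphic if and only if some rotation or reflection of the $(n+3)$-gon maps $T_1$ to $T_2$. -/

import Mathlib

namespace Associahedron

/-! ### Diagonals and triangulations of the convex `(n+3)`-gon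

The vertices of the polygon are labelled cyclically by `Fin (n + 3)` (addition in `Fin (n + 3)` is
modulo `n + 3`); a segment between two vertices is an element of `Sym2 (Fin (n + 3))`. -/

/-- A diagonal joins two distinct vertices that are not joined by a side of the polygon. -/
def IsDiagonal {n : ℕ} (d : Sym2 (Fin (n + 3))) : Prop :=
  ¬ d.IsDiag ∧ ∀ i : Fin (n + 3), d ≠ s(i, i + 1)

/-- Two segments cross (in interior points) if they are the two diagonals `ik`, `jl` of a
quadrilateral with vertices `i, j, k, l` in this cyclic order. -/
def Crosses {n : ℕ} (d e : Sym2 (Fin (n + 3))) : Prop :=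
  ∃ i j k l : Fin (n + 3), i < j ∧ j < k ∧ k < l ∧
    ((d = s(i, k) ∧ e = s(j, l)) ∨ (d = s(j, l) ∧ e = s(i, k)))

instance {n : ℕ} (d : Sym2 (Fin (n + 3))) : Decidable (IsDiagonal d) := by
  unfold IsDiagonal
  infer_instance

instance {n : ℕ} (d e : Sym2 (Fin (n + 3))) : Decidable (Crosses d e) := by
  unfold Crosses
  infer_instance

/-- A non-crossing set of diagonals. -/
def IsNonCrossing {n : ℕ} (S : Finset (Sym2 (Fin (n + 3)))) : Prop :=
  (∀ d ∈ S, IsDiagonal d) ∧ ∀ d ∈ S, ∀ e ∈ S, ¬ Crosses d e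

/-- A triangulation of the `(n+3)`-gon, given by its set of diagonals: a maximal non-crossing set
of diagonals. -/
structure Triangulation (n : ℕ) where
  diagonals : Finset (Sym2 (Fin (n + 3)))
  maximal : Maximal IsNonCrossing diagonals

/-- The rotations and the reflections of the `(n+3)`-gon, as maps on its vertices. -/
def IsRotationOrReflection {n : ℕ} (φ : Fin (n + 3) → Fin (n + 3)) : Prop :=
  (∃ c, ∀ i, φ i = c + i) ∨ (∃ c, ∀ i, φ i = c - i)

/-- Two triangulations are equivalent under rotation-reflection if some rotation or reflection of
the polygon maps the first one to the second one. -/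
def RotationReflectionEquivalent {n : ℕ} (T₁ T₂ : Triangulation n) : Prop :=
  ∃ φ : Fin (n + 3) → Fin (n + 3),
    IsRotationOrReflection φ ∧ T₁.diagonals.image (Sym2.map φ) = T₂.diagonals

/-! ### The Santos fan of a seed triangulation -/

section Fan

variable {V : Type*} [AddCommGroup V] [Module ℝ V]

/-- The vector `v_d` of a diagonal `d`, for a seed triangulation `T` and a basis `α` indexed by the
diagonals of `T`: it is `- α_d` if `d` is in `T`, and otherwise the sum of the `α_δ` over the
diagonals `δ` of `T` that are crossed by `d`. -/
noncomputable def santosVector {n : ℕ} (T : Triangulation n) (α : Module.Basis T.diagonals ℝ V)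
    (d : Sym2 (Fin (n + 3))) : V :=
  if h : d ∈ T.diagonals then - α ⟨d, h⟩
  else ∑ δ : T.diagonals, if Crosses d δ then α δ else 0

/-- The convex cone spanned by the vectors of a set `S` of diagonals. -/
noncomputable def santosCone {n : ℕ} (T : Triangulation n) (α : Module.Basis T.diagonals ℝ V)
    (S : Finset (Sym2 (Fin (n + 3)))) : PointedCone ℝ V :=
  PointedCone.hull ℝ (santosVector T α '' (S : Set (Sym2 (Fin (n + 3)))))

/-- The Santos fan with seed triangulation `T`. Its maximal cones are spanned by the triangulations
of the polygon; the faces of these are the cones spanned by the subsets of triangulations, that is,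
by the non-crossing sets of diagonals. -/
def santosFan {n : ℕ} (T : Triangulation n) (α : Module.Basis T.diagonals ℝ V) :
    Set (PointedCone ℝ V) :=
  {C | ∃ S, IsNonCrossing S ∧ C = santosCone T α S}

/-- Two fans, given as sets of cones, are linearly isomorphic if a linear isomorphism of the ambient
spaces maps the cones of the first one to the cones of the second one. -/
def LinearlyIsomorphic {V' : Type*} [AddCommGroup V'] [Module ℝ V']
    (F : Set (PointedCone ℝ V)) (F' : Set (PointedCone ℝ V')) : Prop :=
  ∃ L : V ≃ₗ[ℝ] V', (fun C => PointedCone.map (L : V →ₗ[ℝ] V') C) '' F = F'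

end Fan

/-! ### Polytopes and their normal fans -/

section Polytope

variable {W : Type*} [AddCommGroup W] [Module ℝ W]

/-- A (non-empty) polytope is the convex hull of a non-empty finite set of points. -/
def IsPolytope (P : Set W) : Prop :=
  ∃ s : Finset W, s.Nonempty ∧ P = convexHull ℝ (s : Set W)

/-- The face of `P` on which the linear functional `f` attains its maximum over `P`. -/
def face (P : Set W) (f : Module.Dual ℝ W) : Set W :=
  {x | x ∈ P ∧ ∀ y ∈ P, f y ≤ f x}

/-- The (exterior) normal cone of a face `F` of `P`: all linear functionals whose maximum over `P`
is attained at every point of `F`. -/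
def normalCone (P F : Set W) : PointedCone ℝ (Module.Dual ℝ W) where
  carrier := {g | ∀ x ∈ F, ∀ y ∈ P, g y ≤ g x}
  zero_mem' := fun _ _ _ _ => le_rfl
  add_mem' := fun hg hh x hx y hy => add_le_add (hg x hx y hy) (hh x hx y hy)
  smul_mem' := fun c _ hg x hx y hy => mul_le_mul_of_nonneg_left (hg x hx y hy) c.2

/-- The normal fan of `P`: the set of the normal cones of the non-empty faces of `P`. -/
def normalFan (P : Set W) : Set (PointedCone ℝ (Module.Dual ℝ W)) :=
  {C | ∃ f : Module.Dual ℝ W, (face P f).Nonempty ∧ C = normalCone P (face P f)}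

/-- Two polytopes are normally isomorphic if their normal fans are linearly isomorphic. -/
def NormallyIsomorphic {W' : Type*} [AddCommGroup W'] [Module ℝ W']
    (P : Set W) (P' : Set W') : Prop :=
  LinearlyIsomorphic (normalFan P) (normalFan P')

/-- `P` is a Santos associahedron with seed triangulation `T`: a polytope whose normal fan is the
Santos fan of `T`, with respect to some basis of the dual space. -/
def IsSantosAssociahedron {n : ℕ} (T : Triangulation n) (P : Set W) : Prop :=
  IsPolytope P ∧
    ∃ α : Module.Basis T.diagonals ℝ (Module.Dual ℝ W), normalFan P = santosFan T α

end Polytope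

end Associahedron

/-! A rotation or reflection preserves crossings, so if it carries `T₁` to `T₂`, re-indexing one
basis along it carries every vector `v_d`, hence every cone, to its counterpart
(`santosVector_map`).

For the converse with `2 ≤ n`, distinct diagonals span distinct rays (`eq_of_santosVector_eq_smul`).
A linear isomorphism of the fans therefore induces a bijection `f` of the diagonals. Two diagonals
span a common cone exactly when they do not cross, so `f` preserves crossing
(`exists_noncrossing_images`). Ears are recognizable from crossings alone, and the ears that a
diagonal crosses are those at its endpoints, so `f` comes from a rotation or reflection
(`exists_isRotationOrReflection`).

It remains to see that `f` carries `T₁` to `T₂`. Linearity also preserves opposite rays, and these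
correspond exactly to the pairs formed by a diagonal of the seed and its flip
(`santosVector_opposite_iff`). Within such a pair the seed diagonal is singled out by crossings: its
flip is the only paired diagonal that it crosses, whereas the flip also crosses some other flip
(`mem_diagonals_iff`). So the fan determines the seed up to symmetry of the polygon.

For `n < 2` all triangulations are equivalent anyway. -/

namespace Associahedron

/-! ### Positions of vertices and crossings -/

/-- Exactly one of `z`, `w` lies strictly between `x` and `y`, and the other one strictly outside. -/
def NatCross (x y z w : ℕ) : Prop :=
  (((x < z ∧ z < y) ∨ (y < z ∧ z < x)) ∧ ((w < x ∧ w < y) ∨ (x < w ∧ y < w))) ∨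
  (((x < w ∧ w < y) ∨ (y < w ∧ w < x)) ∧ ((z < x ∧ z < y) ∨ (x < z ∧ y < z)))

/-- The position of the vertex `x` when one walks around the polygon starting at `a`. -/
def pos {n : ℕ} (a x : Fin (n + 3)) : ℕ := (x - a).val

variable {n : ℕ}

theorem pos_eq (a x : Fin (n + 3)) :
    (a.val ≤ x.val ∧ pos a x = x.val - a.val) ∨
      (x.val < a.val ∧ pos a x = n + 3 + x.val - a.val) := by
  unfold pos
  have h1 := a.isLt
  have h2 := x.isLt
  rw [Fin.val_sub]
  by_cases h : a.val ≤ x.val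
  · left
    refine ⟨h, ?_⟩
    have : n + 3 - a.val + x.val = (x.val - a.val) + (n + 3) := by omega
    rw [this, Nat.add_mod_right, Nat.mod_eq_of_lt (by omega)]
  · right
    refine ⟨by omega, ?_⟩
    rw [Nat.mod_eq_of_lt (by omega)]
    omega

theorem pos_lt (a x : Fin (n + 3)) : pos a x < n + 3 := (x - a).isLt

theorem pos_self (a : Fin (n + 3)) : pos a a = 0 := by
  have := pos_eq a a
  omega

theorem pos_injective {a x y : Fin (n + 3)} (h : pos a x = pos a y) : x = y := by
  have := pos_eq a x
  have := pos_eq a y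
  apply Fin.ext
  omega

theorem pos_ne {x y : Fin (n + 3)} (a : Fin (n + 3)) (h : x ≠ y) : pos a x ≠ pos a y :=
  fun h' => h (pos_injective h')

theorem val_succ (x : Fin (n + 3)) :
    ((x + 1).val = x.val + 1 ∧ x.val + 1 < n + 3) ∨ ((x + 1).val = 0 ∧ x.val + 1 = n + 3) := by
  have := x.isLt
  rw [Fin.val_add_one]
  split_ifs with h
  · right
    rw [h]
    simp
  · left
    have : x.val ≠ n + 2 := fun h' => h (Fin.ext (by simpa using h'))
    omega

theorem pos_succ (a x : Fin (n + 3)) :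
    (pos a (x + 1) = pos a x + 1 ∧ pos a x + 1 < n + 3) ∨
      (pos a (x + 1) = 0 ∧ pos a x + 1 = n + 3) := by
  have := pos_eq a x
  have := pos_eq a (x + 1)
  have := val_succ x
  omega

theorem pos_change (a b x : Fin (n + 3)) :
    (pos a b ≤ pos a x ∧ pos b x = pos a x - pos a b) ∨
      (pos a x < pos a b ∧ pos b x = n + 3 + pos a x - pos a b) := by
  have := pos_eq a x
  have := pos_eq a b
  have := pos_eq b x
  omega

theorem exists_pos_eq (a : Fin (n + 3)) {k : ℕ} (hk : k < n + 3) : ∃ x, pos a x = k :=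
  ⟨⟨k, hk⟩ + a, by simp [pos]⟩

theorem crosses_mk (x y z w : Fin (n + 3)) :
    Crosses s(x, y) s(z, w) ↔ NatCross x.val y.val z.val w.val := by
  constructor
  · rintro ⟨i, j, k, l, h1, h2, h3, h⟩
    simp only [Sym2.eq_iff] at h
    rw [Fin.lt_def] at h1 h2 h3
    unfold NatCross
    rcases h with ⟨⟨rfl, rfl⟩ | ⟨rfl, rfl⟩, ⟨rfl, rfl⟩ | ⟨rfl, rfl⟩⟩ |
      ⟨⟨rfl, rfl⟩ | ⟨rfl, rfl⟩, ⟨rfl, rfl⟩ | ⟨rfl, rfl⟩⟩ <;> omega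
  · intro h
    have aux : ∀ x y z w : Fin (n + 3), x < z → z < y → y < w →
        Crosses s(x, y) s(z, w) ∧ Crosses s(z, w) s(x, y) := fun x y z w h1 h2 h3 =>
      ⟨⟨x, z, y, w, h1, h2, h3, Or.inl ⟨rfl, rfl⟩⟩, ⟨x, z, y, w, h1, h2, h3, Or.inr ⟨rfl, rfl⟩⟩⟩
    simp only [NatCross, ← Fin.lt_def] at h
    rcases h with ⟨⟨h1, h2⟩ | ⟨h1, h2⟩, ⟨h3, h4⟩ | ⟨h3, h4⟩⟩ |
      ⟨⟨h1, h2⟩ | ⟨h1, h2⟩, ⟨h3, h4⟩ | ⟨h3, h4⟩⟩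
    · have := (aux w z x y h3 h1 h2).2; rwa [Sym2.eq_swap (a := w)] at this
    · exact (aux x y z w h1 h2 h4).1
    · have := (aux w z y x h4 h1 h2).2
      rwa [Sym2.eq_swap (a := w), Sym2.eq_swap (a := y)] at this
    · have := (aux y x z w h1 h2 h3).1; rwa [Sym2.eq_swap (a := y)] at this
    · exact (aux z w x y h3 h1 h2).2
    · have := (aux x y w z h1 h2 h4).1; rwa [Sym2.eq_swap (a := w)] at this
    · have := (aux z w y x h4 h1 h2).2; rwa [Sym2.eq_swap (a := y)] at this
    · have := (aux y x w z h1 h2 h3).1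
      rwa [Sym2.eq_swap (a := w), Sym2.eq_swap (a := y)] at this

theorem NatCross.rotate_one {N x y z w x' y' z' w' : ℕ}
    (hx : x < N) (hy : y < N) (hz : z < N) (hw : w < N)
    (hx' : (1 ≤ x ∧ x' = x - 1) ∨ (x = 0 ∧ x' = N - 1))
    (hy' : (1 ≤ y ∧ y' = y - 1) ∨ (y = 0 ∧ y' = N - 1))
    (hz' : (1 ≤ z ∧ z' = z - 1) ∨ (z = 0 ∧ z' = N - 1))
    (hw' : (1 ≤ w ∧ w' = w - 1) ∨ (w = 0 ∧ w' = N - 1)) :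
    NatCross x' y' z' w' ↔ NatCross x y z w := by
  unfold NatCross
  rcases hx' with ⟨h1, rfl⟩ | ⟨rfl, rfl⟩ <;> rcases hy' with ⟨h2, rfl⟩ | ⟨rfl, rfl⟩ <;>
  rcases hz' with ⟨h3, rfl⟩ | ⟨rfl, rfl⟩ <;> rcases hw' with ⟨h4, rfl⟩ | ⟨rfl, rfl⟩ <;>
  grind

theorem NatCross.reflect {N x y z w x' y' z' w' : ℕ}
    (hx : x < N) (hy : y < N) (hz : z < N) (hw : w < N)
    (hx' : (x = 0 ∧ x' = 0) ∨ (0 < x ∧ x' + x = N))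
    (hy' : (y = 0 ∧ y' = 0) ∨ (0 < y ∧ y' + y = N))
    (hz' : (z = 0 ∧ z' = 0) ∨ (0 < z ∧ z' + z = N))
    (hw' : (w = 0 ∧ w' = 0) ∨ (0 < w ∧ w' + w = N)) :
    NatCross x' y' z' w' ↔ NatCross x y z w := by
  unfold NatCross
  rcases hx' with ⟨rfl, rfl⟩ | ⟨p1, h1⟩ <;> rcases hy' with ⟨rfl, rfl⟩ | ⟨p2, h2⟩ <;>
  rcases hz' with ⟨rfl, rfl⟩ | ⟨p3, h3⟩ <;> rcases hw' with ⟨rfl, rfl⟩ | ⟨p4, h4⟩ <;>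
  grind

theorem pos_succ_left (a x : Fin (n + 3)) :
    (1 ≤ pos a x ∧ pos (a + 1) x = pos a x - 1) ∨ (pos a x = 0 ∧ pos (a + 1) x = n + 3 - 1) := by
  have h := pos_change a (a + 1) x
  have := pos_succ a a
  have := pos_self a
  omega

/-- Crossing depends only on the cyclic order, so moving the base point by one step changes nothing.
Later arguments measure positions from a convenient vertex and reduce to linear arithmetic. -/
theorem crosses_pos (a x y z w : Fin (n + 3)) :
    Crosses s(x, y) s(z, w) ↔ NatCross (pos a x) (pos a y) (pos a z) (pos a w) := by
  induction a using Fin.induction with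
  | zero => simp [crosses_mk, pos]
  | succ a ih =>
    rw [ih, ← Fin.coeSucc_eq_succ]
    exact (NatCross.rotate_one (pos_lt _ x) (pos_lt _ y) (pos_lt _ z) (pos_lt _ w)
      (pos_succ_left _ x) (pos_succ_left _ y) (pos_succ_left _ z) (pos_succ_left _ w)).symm

theorem crosses_comm {d e : Sym2 (Fin (n + 3))} : Crosses d e ↔ Crosses e d := by
  induction d with | _ x y
  induction e with | _ z w
  rw [crosses_mk, crosses_mk]
  unfold NatCross
  omega

theorem not_crosses_self (d : Sym2 (Fin (n + 3))) : ¬ Crosses d d := by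
  induction d with | _ x y
  rw [crosses_mk]
  unfold NatCross
  omega

theorem isDiagonal_pos (a x y : Fin (n + 3)) :
    IsDiagonal s(x, y) ↔
      pos a x ≠ pos a y ∧ pos a x + 1 ≠ pos a y ∧ pos a y + 1 ≠ pos a x ∧
        ¬ (pos a x = 0 ∧ pos a y + 1 = n + 3) ∧ ¬ (pos a y = 0 ∧ pos a x + 1 = n + 3) := by
  have hx := pos_succ a x
  have hy := pos_succ a y
  have h1 : IsDiagonal s(x, y) ↔ x ≠ y ∧ y ≠ x + 1 ∧ x ≠ y + 1 := by
    unfold IsDiagonal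
    simp only [Sym2.mk_isDiag_iff, ne_eq, Sym2.eq_iff]
    constructor
    · rintro ⟨h, h'⟩
      exact ⟨h, fun h2 => h' x (Or.inl ⟨rfl, h2⟩), fun h2 => h' y (Or.inr ⟨h2, rfl⟩)⟩
    · rintro ⟨h, h', h''⟩
      refine ⟨h, ?_⟩
      rintro i (⟨rfl, h2⟩ | ⟨h2, rfl⟩)
      · exact h' h2
      · exact h'' h2
  have e : ∀ u v : Fin (n + 3), u = v ↔ pos a u = pos a v :=
    fun u v => ⟨fun h => by rw [h], pos_injective⟩
  rw [h1]
  simp only [ne_eq, e]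
  have := pos_lt a x
  have := pos_lt a y
  omega

theorem Crosses.isDiagonal {d e : Sym2 (Fin (n + 3))} (h : Crosses d e) : IsDiagonal d := by
  induction d with | _ x y
  induction e with | _ z w
  rw [crosses_pos x] at h
  rw [isDiagonal_pos x]
  unfold NatCross at h
  have := pos_lt x x
  have := pos_lt x y
  have := pos_lt x z
  have := pos_lt x w
  omega

/-! ### Rotations and reflections -/

theorem IsRotationOrReflection.injective {φ : Fin (n + 3) → Fin (n + 3)}
    (h : IsRotationOrReflection φ) : Function.Injective φ := by
  rcases h with ⟨c, h⟩ | ⟨c, h⟩ <;> intro x y hxy <;> simpa [h] using hxy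

theorem IsRotationOrReflection.pos_apply {φ : Fin (n + 3) → Fin (n + 3)}
    (h : IsRotationOrReflection φ) :
    (∀ x, pos (φ 0) (φ x) = pos 0 x) ∨
      (∀ x, (x = 0 ∧ pos (φ 0) (φ x) = 0) ∨
        (0 < pos 0 x ∧ pos (φ 0) (φ x) + pos 0 x = n + 3)) := by
  rcases h with ⟨c, h⟩ | ⟨c, h⟩
  · left
    intro x
    simp [h, pos]
  · right
    intro x
    by_cases hx : x = 0
    · left
      exact ⟨hx, by rw [hx, pos_self]⟩
    · right
      have h0 : φ x - φ 0 = 0 - x := by simp [h]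
      have h1 : pos (φ 0) (φ x) = pos x 0 := by rw [pos, pos, h0]
      have h2 := pos_change 0 x 0
      have h3 := pos_self (0 : Fin (n + 3))
      have h4 := pos_ne 0 hx
      have h5 := pos_lt 0 x
      omega

theorem IsRotationOrReflection.crosses_iff {φ : Fin (n + 3) → Fin (n + 3)}
    (h : IsRotationOrReflection φ) (d e : Sym2 (Fin (n + 3))) :
    Crosses (d.map φ) (e.map φ) ↔ Crosses d e := by
  induction d with | _ x y
  induction e with | _ z w
  simp only [Sym2.map_mk]
  rw [crosses_pos (φ 0), crosses_pos 0 x]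
  rcases h.pos_apply with h | h
  · simp only [h]
  · have e : ∀ u : Fin (n + 3), (pos 0 u = 0 ∧ pos (φ 0) (φ u) = 0) ∨
        (0 < pos 0 u ∧ pos (φ 0) (φ u) + pos 0 u = n + 3) := fun u => by
      rcases h u with ⟨rfl, h⟩ | h
      · exact Or.inl ⟨pos_self _, h⟩
      · exact Or.inr h
    have hx := e x
    have hy := e y
    have hz := e z
    have hw := e w
    have := pos_lt 0 x
    have := pos_lt 0 y
    have := pos_lt 0 z
    have := pos_lt 0 w
    exact NatCross.reflect ‹_› ‹_› ‹_› ‹_› hx hy hz hw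

/-- A diagonal from `x` crosses the segment joining the two neighbours of `x`. This expresses being
a diagonal through crossing, so maps that preserve crossing preserve it. -/
theorem isDiagonal_iff_exists_crosses (d : Sym2 (Fin (n + 3))) :
    IsDiagonal d ↔ ∃ e, Crosses d e := by
  refine ⟨fun h => ?_, fun ⟨e, h⟩ => h.isDiagonal⟩
  induction d with | _ x y
  rw [isDiagonal_pos x, pos_self] at h
  obtain ⟨z, hz⟩ := exists_pos_eq (n := n) x (k := 1) (by omega)
  obtain ⟨w, hw⟩ := exists_pos_eq (n := n) x (k := n + 2) (by omega)
  refine ⟨s(z, w), ?_⟩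
  rw [crosses_pos x, pos_self, hz, hw]
  unfold NatCross
  have := pos_lt x y
  omega

theorem IsRotationOrReflection.map_bijective {φ : Fin (n + 3) → Fin (n + 3)}
    (h : IsRotationOrReflection φ) : Function.Bijective (Sym2.map φ) :=
  Finite.injective_iff_bijective.1 (Sym2.map.injective h.injective)

theorem IsRotationOrReflection.isDiagonal_iff {φ : Fin (n + 3) → Fin (n + 3)}
    (h : IsRotationOrReflection φ) (d : Sym2 (Fin (n + 3))) :
    IsDiagonal (d.map φ) ↔ IsDiagonal d := by
  rw [isDiagonal_iff_exists_crosses, isDiagonal_iff_exists_crosses]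
  constructor
  · rintro ⟨e, he⟩
    obtain ⟨e, rfl⟩ := h.map_bijective.2 e
    exact ⟨e, (h.crosses_iff d e).1 he⟩
  · rintro ⟨e, he⟩
    exact ⟨e.map φ, (h.crosses_iff d e).2 he⟩

theorem IsRotationOrReflection.isNonCrossing_image {φ : Fin (n + 3) → Fin (n + 3)}
    (h : IsRotationOrReflection φ) (S : Finset (Sym2 (Fin (n + 3)))) :
    IsNonCrossing (S.image (Sym2.map φ)) ↔ IsNonCrossing S := by
  simp only [IsNonCrossing, Finset.forall_mem_image, h.isDiagonal_iff, h.crosses_iff]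

end Associahedron

namespace Associahedron

variable {n : ℕ}

/-! ### Edges of a triangulation -/

/-- `x` and `y` are joined by a side of the polygon or by a diagonal of `T`. -/
def Triangulation.Edge (T : Triangulation n) (x y : Fin (n + 3)) : Prop :=
  s(x, y) ∈ T.diagonals ∨ y = x + 1 ∨ x = y + 1

namespace Triangulation

variable {T : Triangulation n}

theorem isDiagonal {d : Sym2 (Fin (n + 3))} (h : d ∈ T.diagonals) : IsDiagonal d :=
  T.maximal.prop.1 d h

theorem not_crosses {d e : Sym2 (Fin (n + 3))} (hd : d ∈ T.diagonals) (he : e ∈ T.diagonals) :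
    ¬ Crosses d e :=
  T.maximal.prop.2 d hd e he

theorem mem_of_not_crosses {d : Sym2 (Fin (n + 3))} (hd : IsDiagonal d)
    (h : ∀ e ∈ T.diagonals, ¬ Crosses d e) : d ∈ T.diagonals := by
  have h1 : IsNonCrossing (insert d T.diagonals) := by
    constructor
    · intro e he
      rcases Finset.mem_insert.1 he with rfl | he
      · exact hd
      · exact isDiagonal he
    · intro e he e' he'
      rw [Finset.mem_insert] at he he'
      rcases he with rfl | he <;> rcases he' with rfl | he'
      · exact not_crosses_self _
      · exact h _ he'
      · exact fun h' => h _ he (crosses_comm.1 h')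
      · exact not_crosses he he'
  exact T.maximal.le_of_ge h1 (Finset.subset_insert _ _) (Finset.mem_insert_self _ _)

theorem Edge.symm {x y : Fin (n + 3)} (h : T.Edge x y) : T.Edge y x := by
  rcases h with h | h | h
  · exact Or.inl (Sym2.eq_swap (a := x) ▸ h)
  · exact Or.inr (Or.inr h)
  · exact Or.inr (Or.inl h)

theorem edge_succ (x : Fin (n + 3)) : T.Edge x (x + 1) := Or.inr (Or.inl rfl)

theorem Edge.mem_of_isDiagonal {x y : Fin (n + 3)} (h : T.Edge x y) (hd : IsDiagonal s(x, y)) :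
    s(x, y) ∈ T.diagonals := by
  rcases h with h | h | h
  · exact h
  · exact absurd (by rw [h]) (hd.2 x)
  · exact absurd (by rw [h, Sym2.eq_swap]) (hd.2 y)

theorem isDiagonal_of_ne {x y : Fin (n + 3)} (h : x ≠ y) :
    IsDiagonal s(x, y) ∨ y = x + 1 ∨ x = y + 1 := by
  by_contra! h'
  obtain ⟨h1, h2, h3⟩ := h'
  apply h1
  constructor
  · simpa using h
  · intro i hi
    rw [Sym2.eq_iff] at hi
    rcases hi with ⟨rfl, hi⟩ | ⟨hi, rfl⟩
    · exact h2 hi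
    · exact h3 hi

theorem Edge.not_crosses {x y z w : Fin (n + 3)} (h : T.Edge x y) (h' : T.Edge z w) :
    ¬ Crosses s(x, y) s(z, w) := fun hc =>
  Triangulation.not_crosses (h.mem_of_isDiagonal hc.isDiagonal)
    (h'.mem_of_isDiagonal (crosses_comm.1 hc).isDiagonal) hc

theorem Edge.not_natCross {x y z w : Fin (n + 3)} (a : Fin (n + 3)) (h : T.Edge x y)
    (h' : T.Edge z w) : ¬ NatCross (pos a x) (pos a y) (pos a z) (pos a w) := by
  rw [← crosses_pos]
  exact h.not_crosses h'

theorem edge_of_not_natCross {x y : Fin (n + 3)} (a : Fin (n + 3)) (h : x ≠ y)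
    (h' : ∀ z w, T.Edge z w → ¬ NatCross (pos a x) (pos a y) (pos a z) (pos a w)) :
    T.Edge x y := by
  rcases isDiagonal_of_ne h with h1 | h1
  · refine Or.inl (mem_of_not_crosses h1 fun e he => ?_)
    induction e with | _ z w
    rw [crosses_pos a]
    exact h' z w (Or.inl he)
  · exact Or.inr h1

theorem exists_crosses_of_not_mem {d : Sym2 (Fin (n + 3))} (hd : IsDiagonal d)
    (h : d ∉ T.diagonals) : ∃ e ∈ T.diagonals, Crosses d e := by
  by_contra! h'
  exact h (mem_of_not_crosses hd h')

/-- The first triangle that is met by a segment which is not an edge. -/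
theorem exists_first_triangle {a b : Fin (n + 3)} (hab : a ≠ b) (h : ¬ T.Edge a b) :
    ∃ x y, pos a x < pos a b ∧ pos a b < pos a y ∧ 0 < pos a x ∧
      T.Edge a x ∧ T.Edge a y ∧ T.Edge x y := by
  classical
  have hb := pos_ne a hab
  have ha := pos_self a
  have hb' := pos_lt a b
  -- `x` is the last neighbour of `a` before `b`, and `y` below is the first one after `b`. The
  -- polygon sides at `a` guarantee that both exist.
  obtain ⟨x, hx, hxmax⟩ := Finset.exists_max_image
    (Finset.univ.filter fun x => T.Edge a x ∧ pos a x < pos a b ∧ 0 < pos a x) (pos a) (by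
      refine ⟨a + 1, ?_⟩
      have h1 := pos_succ a a
      have : pos a b ≠ pos a (a + 1) := pos_ne a fun h' => h (h' ▸ edge_succ a)
      simp only [Finset.mem_filter, Finset.mem_univ, true_and]
      exact ⟨edge_succ a, by omega, by omega⟩)
  obtain ⟨y, hy, hymin⟩ := Finset.exists_min_image
    (Finset.univ.filter fun x => T.Edge a x ∧ pos a b < pos a x) (pos a) (by
      obtain ⟨c, hc⟩ := exists_pos_eq a (k := n + 2) (by omega)
      have h1 := pos_succ a c
      have h2 : c + 1 = a := pos_injective (a := a) (by omega)
      have h3 : T.Edge a c := Or.inr (Or.inr h2.symm)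
      have : pos a b ≠ pos a c := pos_ne a fun h' => h (h' ▸ h3)
      refine ⟨c, ?_⟩
      simp only [Finset.mem_filter, Finset.mem_univ, true_and]
      exact ⟨h3, by omega⟩)
  simp only [Finset.mem_filter, Finset.mem_univ, true_and, and_imp] at hx hy hxmax hymin
  refine ⟨x, y, hx.2.1, hy.2, hx.2.2, hx.1, hy.1, edge_of_not_natCross a ?_ ?_⟩
  · rintro rfl
    omega
  -- An edge crossing `xy` would have to leave the triangle through `ax` or `ay`, or end at `a` as a
  -- neighbour strictly between `x` and `y`; all are excluded.
  · intro z w hzw hc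
    have key : ∀ w, T.Edge a w → ¬ (pos a x < pos a w ∧ pos a w < pos a y) := fun w hw hw' => by
      have h1 := hxmax w hw
      have h2 := hymin w hw
      have : pos a b ≠ pos a w := pos_ne a fun h' => h (h' ▸ hw)
      omega
    have h1 := hx.1.not_natCross a hzw
    have h2 := hy.1.not_natCross a hzw
    have h3 : pos a z = 0 → ¬ (pos a x < pos a w ∧ pos a w < pos a y) := fun h' =>
      key w (pos_injective (h'.trans ha.symm) ▸ hzw)
    have h4 : pos a w = 0 → ¬ (pos a x < pos a z ∧ pos a z < pos a y) := fun h' =>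
      key z (pos_injective (h'.trans ha.symm) ▸ hzw.symm)
    rw [ha] at h1 h2
    unfold NatCross at *
    omega

/-- The apex of the triangle on one side of an edge. -/
theorem exists_apex {a b : Fin (n + 3)} (h : T.Edge a b) (hb : 2 ≤ pos a b) :
    ∃ k, 0 < pos a k ∧ pos a k < pos a b ∧ T.Edge a k ∧ T.Edge k b := by
  classical
  have ha := pos_self a
  obtain ⟨x, hx, hxmax⟩ := Finset.exists_max_image
    (Finset.univ.filter fun x => T.Edge a x ∧ pos a x < pos a b ∧ 0 < pos a x) (pos a) (by
      refine ⟨a + 1, ?_⟩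
      have h1 := pos_succ a a
      simp only [Finset.mem_filter, Finset.mem_univ, true_and]
      exact ⟨edge_succ a, by omega, by omega⟩)
  simp only [Finset.mem_filter, Finset.mem_univ, true_and, and_imp] at hx hxmax
  refine ⟨x, hx.2.2, hx.2.1, hx.1, edge_of_not_natCross a ?_ ?_⟩
  · rintro rfl
    omega
  · intro z w hzw hc
    have h1 := hx.1.not_natCross a hzw
    have h2 := h.not_natCross a hzw
    have key : ∀ w, T.Edge a w → ¬ (pos a x < pos a w ∧ pos a w < pos a b) := fun w hw hw' => by
      have h1 := hxmax w hw
      omega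
    have h3 : pos a z = 0 → ¬ (pos a x < pos a w ∧ pos a w < pos a b) := fun h' =>
      key w (pos_injective (h'.trans ha.symm) ▸ hzw)
    have h4 : pos a w = 0 → ¬ (pos a x < pos a z ∧ pos a z < pos a b) := fun h' =>
      key z (pos_injective (h'.trans ha.symm) ▸ hzw.symm)
    rw [ha] at h1 h2
    unfold NatCross at *
    omega

/-- The quadrilateral formed by the two triangles at a diagonal. -/
theorem exists_quadrilateral {a b : Fin (n + 3)} (h : s(a, b) ∈ T.diagonals) :
    ∃ k l, 0 < pos a k ∧ pos a k < pos a b ∧ pos a b < pos a l ∧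
      T.Edge a k ∧ T.Edge k b ∧ T.Edge b l ∧ T.Edge l a := by
  have hd := (isDiagonal_pos a a b).1 (isDiagonal h)
  have ha := pos_self a
  have hE : T.Edge a b := Or.inl h
  have h1 := pos_change a b a
  have h2 := pos_lt a b
  obtain ⟨k, hk1, hk2, hk3, hk4⟩ := exists_apex hE (by omega)
  obtain ⟨l, hl1, hl2, hl3, hl4⟩ := exists_apex hE.symm (by omega)
  have h3 := pos_change a b l
  have h4 := pos_lt a l
  exact ⟨k, l, hk1, hk2, by omega, hk3, hk4, hl3, hl4⟩

/-- `d` is the flip of the diagonal `e` of `T`: it crosses `e` and no other diagonal of `T`. -/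
def IsFlip (T : Triangulation n) (e d : Sym2 (Fin (n + 3))) : Prop :=
  e ∈ T.diagonals ∧ ∀ e' ∈ T.diagonals, Crosses d e' ↔ e' = e

theorem IsFlip.crosses {d e : Sym2 (Fin (n + 3))} (h : T.IsFlip e d) : Crosses d e :=
  (h.2 e h.1).2 rfl

theorem IsFlip.not_mem {d e : Sym2 (Fin (n + 3))} (h : T.IsFlip e d) : d ∉ T.diagonals :=
  fun h' => not_crosses h' h.1 h.crosses

/-- An edge of `T` that crosses `kl` enters the quadrilateral; as it crosses none of the four sides,
nor `ab`, it can only be `ab`. -/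
theorem isFlip_of_quadrilateral {a b k l : Fin (n + 3)} (h : s(a, b) ∈ T.diagonals)
    (hk : 0 < pos a k) (hk' : pos a k < pos a b) (hl : pos a b < pos a l)
    (h1 : T.Edge a k) (h2 : T.Edge k b) (h3 : T.Edge b l) (h4 : T.Edge l a) :
    T.IsFlip s(a, b) s(k, l) := by
  refine ⟨h, fun e he => ?_⟩
  induction e with | _ z w
  have hE : T.Edge a b := Or.inl h
  have hzw : T.Edge z w := Or.inl he
  have ha := pos_self a
  have c0 := hE.not_natCross a hzw
  have c1 := h1.not_natCross a hzw
  have c2 := h2.not_natCross a hzw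
  have c3 := h3.not_natCross a hzw
  have c4 := h4.not_natCross a hzw
  have e1 : ∀ u v : Fin (n + 3), u = v ↔ pos a u = pos a v :=
    fun u v => ⟨fun h => by rw [h], pos_injective⟩
  rw [crosses_pos a, Sym2.eq_iff]
  simp only [e1]
  rw [ha] at *
  unfold NatCross at *
  omega

theorem exists_isFlip {e : Sym2 (Fin (n + 3))} (h : e ∈ T.diagonals) : ∃ d, T.IsFlip e d := by
  induction e with | _ a b
  obtain ⟨k, l, h1, h2, h3, h4, h5, h6, h7⟩ := exists_quadrilateral h
  exact ⟨_, isFlip_of_quadrilateral h h1 h2 h3 h4 h5 h6 h7⟩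

/-- In the first triangle `axy` met by `ab`, the segment crosses `xy` but neither `ax` nor `ay`. A
segment with the same crossings enters this triangle through `xy` and cannot leave it, so it ends at
`a`. -/
theorem mem_endpoint_of_crosses_iff {a b z w : Fin (n + 3)} (hab : a ≠ b) (h : ¬ T.Edge a b)
    (h' : ∀ e ∈ T.diagonals, Crosses s(a, b) e ↔ Crosses s(z, w) e) : a ∈ s(z, w) := by
  obtain ⟨x, y, h1, h2, h3, h4, h5, h6⟩ := exists_first_triangle hab h
  have key : ∀ u v, T.Edge u v →
      (NatCross (pos a a) (pos a b) (pos a u) (pos a v) ↔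
        NatCross (pos a z) (pos a w) (pos a u) (pos a v)) := by
    intro u v huv
    rw [← crosses_pos, ← crosses_pos]
    constructor
    · intro hc
      exact (h' _ (huv.mem_of_isDiagonal (crosses_comm.1 hc).isDiagonal)).1 hc
    · intro hc
      exact (h' _ (huv.mem_of_isDiagonal (crosses_comm.1 hc).isDiagonal)).2 hc
  have c1 := key _ _ h4
  have c2 := key _ _ h5
  have c3 := key _ _ h6
  have ha := pos_self a
  have : pos a z = pos a a ∨ pos a w = pos a a := by
    rw [ha] at c1 c2 c3 ⊢
    unfold NatCross at *
    omega
  rw [Sym2.mem_iff]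
  rcases this with h | h
  · exact Or.inl (pos_injective h).symm
  · exact Or.inr (pos_injective h).symm

/-- A diagonal that is not in `T` is determined by the diagonals of `T` that it crosses. -/
theorem eq_of_crosses_iff {d e : Sym2 (Fin (n + 3))} (hd : IsDiagonal d) (hd' : d ∉ T.diagonals)
    (h : ∀ δ ∈ T.diagonals, Crosses d δ ↔ Crosses e δ) : d = e := by
  induction d with | _ a b
  induction e with | _ z w
  have hab : a ≠ b := by simpa using hd.1
  have hE : ¬ T.Edge a b := fun h => hd' (h.mem_of_isDiagonal hd)
  have h1 := mem_endpoint_of_crosses_iff hab hE h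
  have h2 := mem_endpoint_of_crosses_iff hab.symm (fun h => hE h.symm)
    (Sym2.eq_swap (a := a) ▸ h)
  exact (Sym2.mem_and_mem_iff hab).1 ⟨h1, h2⟩ |>.symm

theorem IsFlip.eq {d d' e : Sym2 (Fin (n + 3))} (h : T.IsFlip e d) (h' : T.IsFlip e d') :
    d = d' :=
  eq_of_crosses_iff h.crosses.isDiagonal h.not_mem fun δ hδ => by rw [h.2 δ hδ, h'.2 δ hδ]

/-- A segment that enters one of the two triangles through a side and does not pass through `ab`
cuts off `k` or `l`, hence separates `k` from `l`. -/
theorem NatCross.of_quadrilateral {a k b l p q : ℕ} (h1 : a < k) (h2 : k < b) (h3 : b < l)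
    (h : ¬ NatCross p q a b)
    (hc : NatCross p q a k ∨ NatCross p q k b ∨ NatCross p q b l ∨ NatCross p q l a) :
    NatCross k l p q := by
  rcases hc with hc | hc | hc | hc <;> unfold NatCross at * <;> grind

/-- If the polygon has at least five vertices, then the flip of a diagonal is crossed by the flip
of another diagonal. -/
theorem IsFlip.exists_isFlip_crosses (hn : 2 ≤ n) {d e : Sym2 (Fin (n + 3))} (h : T.IsFlip e d) :
    ∃ e' d', e' ≠ e ∧ T.IsFlip e' d' ∧ Crosses d d' := by
  induction e with | _ a b
  obtain ⟨k, l, h1, h2, h3, h4, h5, h6, h7⟩ := exists_quadrilateral h.1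
  obtain rfl := h.eq (isFlip_of_quadrilateral h.1 h1 h2 h3 h4 h5 h6 h7)
  have ha := pos_self a
  have hl := pos_lt a l
  rw [← ha] at h1
  -- Any side `uv` of the quadrilateral that is a diagonal will do: its flip crosses `uv` but not
  -- `ab`, hence crosses `kl`. Since `2 ≤ n`, the four sides cannot all be polygon sides.
  have aux : ∀ u v : Fin (n + 3), T.Edge u v → IsDiagonal s(u, v) → s(u, v) ≠ s(a, b) →
      (∀ p q : Fin (n + 3), NatCross (pos a p) (pos a q) (pos a u) (pos a v) →
        NatCross (pos a p) (pos a q) (pos a a) (pos a k) ∨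
        NatCross (pos a p) (pos a q) (pos a k) (pos a b) ∨
        NatCross (pos a p) (pos a q) (pos a b) (pos a l) ∨
        NatCross (pos a p) (pos a q) (pos a l) (pos a a)) →
      ∃ e' d', e' ≠ s(a, b) ∧ T.IsFlip e' d' ∧ Crosses s(k, l) d' := by
    intro u v huv hd hne hcr
    obtain ⟨x, hx⟩ := exists_isFlip (huv.mem_of_isDiagonal hd)
    refine ⟨_, x, hne, hx, ?_⟩
    induction x with | _ p q
    rw [crosses_pos a]
    refine NatCross.of_quadrilateral h1 h2 h3 ?_ (hcr p q ?_)
    · rw [← crosses_pos, hx.2 _ h.1]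
      exact hne.symm
    · rw [← crosses_pos]
      exact hx.crosses
  have e1 : ∀ u v : Fin (n + 3), u = v ↔ pos a u = pos a v :=
    fun u v => ⟨fun h => by rw [h], pos_injective⟩
  simp only [isDiagonal_pos a, ne_eq, Sym2.eq_iff, e1] at aux
  by_cases c1 : 2 ≤ pos a k
  · exact aux a k h4 (by omega) (by omega) fun p q h => Or.inl h
  by_cases c2 : 2 ≤ pos a b - pos a k
  · exact aux k b h5 (by omega) (by omega) fun p q h => Or.inr (Or.inl h)
  by_cases c3 : 2 ≤ pos a l - pos a b
  · exact aux b l h6 (by omega) (by omega) fun p q h => Or.inr (Or.inr (Or.inl h))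
  · exact aux l a h7 (by omega) (by omega) fun p q h => Or.inr (Or.inr (Or.inr h))

end Triangulation

end Associahedron

namespace Associahedron

variable {n : ℕ}

/-! ### Automorphisms of the crossing relation -/

/-- The diagonal that cuts off the vertex `i`. -/
def ear (i : Fin (n + 3)) : Sym2 (Fin (n + 3)) := s(i - 1, i + 1)

theorem pos_pred_self (i : Fin (n + 3)) : pos i (i - 1) = n + 2 := by
  have h1 := pos_succ i (i - 1)
  have h2 := pos_self i
  rw [sub_add_cancel] at h1
  omega

theorem pos_succ_self (i : Fin (n + 3)) : pos i (i + 1) = 1 := by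
  have h1 := pos_succ i i
  have h2 := pos_self i
  omega

theorem eq_iff_pos (a u v : Fin (n + 3)) : u = v ↔ pos a u = pos a v :=
  ⟨fun h => by rw [h], pos_injective⟩

theorem crosses_ear {x y i : Fin (n + 3)} (h : IsDiagonal s(x, y)) :
    Crosses s(x, y) (ear i) ↔ x = i ∨ y = i := by
  rw [isDiagonal_pos i] at h
  rw [ear, crosses_pos i, eq_iff_pos i x, eq_iff_pos i y, pos_pred_self, pos_succ_self, pos_self]
  have := pos_lt i x
  have := pos_lt i y
  unfold NatCross
  omega

theorem isDiagonal_ear (hn : 2 ≤ n) (i : Fin (n + 3)) : IsDiagonal (ear i) := by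
  rw [ear, isDiagonal_pos i, pos_pred_self, pos_succ_self]
  omega

theorem ear_injective (hn : 2 ≤ n) : Function.Injective (ear (n := n)) := by
  intro i j h
  have h1 := pos_succ i j
  have h2 := pos_succ i (j - 1)
  have h4 := pos_lt i j
  rw [sub_add_cancel] at h2
  simp only [ear, Sym2.eq_iff, eq_iff_pos i, pos_pred_self, pos_succ_self] at h
  rw [eq_iff_pos i, pos_self]
  omega

/-- All segments crossing an ear share the vertex it cuts off, so they do not cross each other. A
diagonal with at least two vertices on each side is crossed by two segments that cross each other.
-/
theorem eq_ear_iff {d : Sym2 (Fin (n + 3))} (hd : IsDiagonal d) :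
    (∃ i, d = ear i) ↔ ∀ x y, Crosses d x → Crosses d y → ¬ Crosses x y := by
  constructor
  · rintro ⟨i, rfl⟩ x y hx hy
    have key : ∀ x, Crosses (ear i) x → ∃ u, x = s(i, u) := by
      intro x hx
      rw [crosses_comm] at hx
      induction x with | _ u v
      rcases (crosses_ear hx.isDiagonal).1 hx with rfl | rfl
      · exact ⟨v, rfl⟩
      · exact ⟨u, Sym2.eq_swap⟩
    obtain ⟨u, rfl⟩ := key x hx
    obtain ⟨v, rfl⟩ := key y hy
    rw [crosses_pos i, pos_self]
    unfold NatCross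
    omega
  · intro h
    induction d with | _ a b
    have ha := pos_self a
    have hb := pos_lt a b
    rw [isDiagonal_pos a, ha] at hd
    by_cases h2 : pos a b = 2
    · have h1 := pos_succ_self a
      have h3 := pos_succ a (a + 1)
      refine ⟨a + 1, ?_⟩
      rw [ear, Sym2.eq_iff, add_sub_cancel_right]
      exact Or.inl ⟨rfl, pos_injective (a := a) (by omega)⟩
    by_cases h2' : pos a b = n + 1
    · have h1 := pos_pred_self a
      have h3 := pos_succ a (a - 1 - 1)
      rw [sub_add_cancel] at h3
      refine ⟨a - 1, ?_⟩
      rw [ear, Sym2.eq_iff, sub_add_cancel]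
      exact Or.inr ⟨rfl, pos_injective (a := a) (by omega)⟩
    · exfalso
      obtain ⟨p, hp⟩ := exists_pos_eq a (k := 1) (by omega)
      obtain ⟨q, hq⟩ := exists_pos_eq a (k := 2) (by omega)
      obtain ⟨r, hr⟩ := exists_pos_eq a (k := pos a b + 1) (by omega)
      obtain ⟨s, hs⟩ := exists_pos_eq a (k := n + 2) (by omega)
      -- `p, q` lie on one side of `ab` and `r, s` on the other, in the cyclic order `p, q, r, s`.
      have := h s(p, r) s(q, s)
      simp only [crosses_pos a, ha, hp, hq, hr, hs] at this
      unfold NatCross at this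
      omega

theorem isRotationOrReflection_of_adjacent {σ : Fin (n + 3) → Fin (n + 3)}
    (hσ : Function.Injective σ) (h : ∀ i, σ (i + 1) = σ i + 1 ∨ σ i = σ (i + 1) + 1) :
    IsRotationOrReflection σ := by
  have hne : ∀ i : Fin (n + 3), i + 1 + 1 ≠ i := by
    intro i hi
    have h1 := pos_succ_self i
    have h2 := pos_succ i (i + 1)
    rw [hi, pos_self] at h2
    omega
  rcases h 0 with h0 | h0
  · have key : ∀ i : Fin (n + 3), σ (i + 1) = σ i + 1 := by
      intro i
      induction i using Fin.induction with
      | zero => exact h0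
      | succ i ih =>
        rw [← Fin.coeSucc_eq_succ]
        -- Reversing direction would give two vertices at distance two the same image.
        exact (h _).resolve_right fun h' =>
          hne i.castSucc (hσ (add_right_cancel (h'.symm.trans ih)))
    refine Or.inl ⟨σ 0, fun i => ?_⟩
    induction i using Fin.induction with
    | zero => simp
    | succ i ih => rw [← Fin.coeSucc_eq_succ, key, ih, add_assoc]
  · have key : ∀ i : Fin (n + 3), σ i = σ (i + 1) + 1 := by
      intro i
      induction i using Fin.induction with
      | zero => exact h0
      | succ i ih =>
        rw [← Fin.coeSucc_eq_succ]
        exact (h _).resolve_left fun h' =>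
          hne i.castSucc (hσ (h'.trans ih.symm))
    refine Or.inr ⟨σ 0, fun i => ?_⟩
    induction i using Fin.induction with
    | zero => simp
    | succ i ih =>
      rw [← Fin.coeSucc_eq_succ]
      have := key i.castSucc
      rw [ih] at this
      rw [← sub_sub, this, add_sub_cancel_right]

/-- For polygons with at least five vertices, the automorphisms of the crossing relation on the
diagonals are induced by rotations and reflections. -/
theorem exists_isRotationOrReflection (hn : 2 ≤ n) {f g : Sym2 (Fin (n + 3)) → Sym2 (Fin (n + 3))}
    (hf : ∀ d, IsDiagonal d → IsDiagonal (f d)) (hg : ∀ d, IsDiagonal d → IsDiagonal (g d))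
    (hgf : ∀ d, IsDiagonal d → g (f d) = d) (hfg : ∀ d, IsDiagonal d → f (g d) = d)
    (hc : ∀ d e, IsDiagonal d → IsDiagonal e → (Crosses (f d) (f e) ↔ Crosses d e)) :
    ∃ φ : Fin (n + 3) → Fin (n + 3),
      IsRotationOrReflection φ ∧ ∀ d, IsDiagonal d → f d = d.map φ := by
  -- By `eq_ear_iff`, ears are defined by crossings, so `f` permutes them; `σ` is the induced
  -- permutation of the vertices. It preserves adjacency because consecutive ears cross.
  have hear : ∀ i, ∃ j, f (ear i) = ear j := by
    intro i
    have hi := isDiagonal_ear hn i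
    rw [eq_ear_iff (hf _ hi)]
    intro x y hx hy
    have hx' := (crosses_comm.1 hx).isDiagonal
    have hy' := (crosses_comm.1 hy).isDiagonal
    rw [← hfg x hx', hc _ _ hi (hg x hx')] at hx
    rw [← hfg y hy', hc _ _ hi (hg y hy')] at hy
    rw [← hfg x hx', ← hfg y hy', hc _ _ (hg x hx') (hg y hy')]
    exact (eq_ear_iff hi).1 ⟨i, rfl⟩ _ _ hx hy
  choose σ hσ using hear
  have hinj : Function.Injective σ := by
    intro i j hij
    apply ear_injective hn
    rw [← hgf _ (isDiagonal_ear hn i), ← hgf _ (isDiagonal_ear hn j), hσ, hσ, hij]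
  have hsurj := (Finite.injective_iff_surjective.1 hinj)
  refine ⟨σ, isRotationOrReflection_of_adjacent hinj fun i => ?_, fun d hd => ?_⟩
  · have h1 : Crosses (ear (i + 1)) (ear i) := by
      have := isDiagonal_ear hn (i + 1)
      rw [ear] at this
      rw [ear, crosses_ear this, add_sub_cancel_right]
      exact Or.inl rfl
    rw [← hc _ _ (isDiagonal_ear hn _) (isDiagonal_ear hn _), hσ, hσ] at h1
    have h2 := isDiagonal_ear hn (σ (i + 1))
    rw [ear] at h1 h2
    rcases (crosses_ear h2).1 h1 with h | h
    · left
      rw [← h, sub_add_cancel]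
    · exact Or.inr h.symm
  · induction d with | _ x y
    have h1 := hf _ hd
    have h2 : ∀ k, Crosses (f s(x, y)) (ear (σ k)) ↔ x = k ∨ y = k := by
      intro k
      rw [← hσ, hc _ _ hd (isDiagonal_ear hn k), crosses_ear hd]
    generalize f s(x, y) = e at *
    induction e with | _ u v
    simp only [crosses_ear h1] at h2
    have hne : σ x ≠ σ y := fun h => hd.1 (by simpa using hinj h)
    rw [Sym2.map_mk]
    refine (Sym2.mem_and_mem_iff hne).1 ⟨?_, ?_⟩
    · rcases (h2 x).2 (Or.inl rfl) with h | h <;> simp [h]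
    · rcases (h2 y).2 (Or.inr rfl) with h | h <;> simp [h]

end Associahedron

namespace Associahedron

variable {n : ℕ}

/-! ### Recognizing the seed triangulation from its flip pairs -/

namespace Triangulation

variable {T : Triangulation n}

theorem IsFlip.isDiagonal {d e : Sym2 (Fin (n + 3))} (h : T.IsFlip e d) :
    IsDiagonal e ∧ IsDiagonal d :=
  ⟨Triangulation.isDiagonal h.1, h.crosses.isDiagonal⟩

/-- If the polygon has at least five vertices, the diagonals of a triangulation can be recognized
from the unordered pairs that consist of a diagonal and its flip. -/
theorem mem_diagonals_iff (hn : 2 ≤ n) (d : Sym2 (Fin (n + 3))) :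
    d ∈ T.diagonals ↔ ∃ e, (T.IsFlip d e ∨ T.IsFlip e d) ∧
      ∀ x y, (T.IsFlip x y ∨ T.IsFlip y x) → Crosses d x → x = e := by
  constructor
  · intro hd
    obtain ⟨e, he⟩ := exists_isFlip hd
    refine ⟨e, Or.inl he, ?_⟩
    rintro x y (h | h) hc
    · exact absurd hc (not_crosses hd h.1)
    · obtain rfl := (h.2 d hd).1 (crosses_comm.1 hc)
      exact h.eq he
  · rintro ⟨e, h | h, h'⟩
    · exact h.1
    · exfalso
      obtain ⟨e', d', hne, hf, hc⟩ := h.exists_isFlip_crosses hn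
      -- The crossing flip `d'` would have to be the partner `e` of `d`, but `e` lies in `T` and
      -- `d'` does not.
      have := h' d' e' (Or.inr hf) hc
      exact hf.not_mem (this ▸ h.1)

end Triangulation

/-! ### The vectors of the Santos fan -/

section Vectors

open Triangulation

variable {V : Type*} [AddCommGroup V] [Module ℝ V] {T : Triangulation n}
  (α : Module.Basis T.diagonals ℝ V)

theorem repr_santosVector_of_mem {d : Sym2 (Fin (n + 3))} (h : d ∈ T.diagonals)
    (δ : T.diagonals) :
    α.repr (santosVector T α d) δ = if d = δ then -1 else 0 := by
  rw [santosVector, dif_pos h, map_neg, Finsupp.neg_apply, Module.Basis.repr_self,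
    Finsupp.single_apply]
  simp only [Subtype.ext_iff]
  split_ifs <;> simp

theorem repr_santosVector_of_not_mem {d : Sym2 (Fin (n + 3))} (h : d ∉ T.diagonals)
    (δ : T.diagonals) :
    α.repr (santosVector T α d) δ = if Crosses d δ then 1 else 0 := by
  rw [santosVector, dif_neg h, map_sum, Finsupp.finsetSum_apply, Finset.sum_eq_single δ]
  · split_ifs <;> simp
  · intro b _ hb
    split_ifs
    · simp [hb]
    · simp
  · simp

theorem repr_smul_apply {c : ℝ} {x y : V} (h : x = c • y) (δ : T.diagonals) :
    α.repr x δ = c * α.repr y δ := by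
  rw [h, map_smul, Finsupp.smul_apply, smul_eq_mul]

theorem exists_repr_santosVector_eq_one {d : Sym2 (Fin (n + 3))} (hd : IsDiagonal d)
    (h : d ∉ T.diagonals) : ∃ δ : T.diagonals, α.repr (santosVector T α d) δ = 1 := by
  obtain ⟨e, he, hc⟩ := exists_crosses_of_not_mem hd h
  exact ⟨⟨e, he⟩, by rw [repr_santosVector_of_not_mem α h, if_pos hc]⟩

theorem santosVector_ne_zero {d : Sym2 (Fin (n + 3))} (hd : IsDiagonal d) :
    santosVector T α d ≠ 0 := by
  intro h0
  by_cases h : d ∈ T.diagonals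
  · have := repr_santosVector_of_mem α h ⟨d, h⟩
    simp [h0] at this
  · obtain ⟨δ, hδ⟩ := exists_repr_santosVector_eq_one α hd h
    simp [h0] at hδ

/-- Distinct diagonals span distinct rays. -/
theorem eq_of_santosVector_eq_smul {d e : Sym2 (Fin (n + 3))} (hd : IsDiagonal d)
    {c : ℝ} (hc : 0 < c) (h : santosVector T α d = c • santosVector T α e) : d = e := by
  have h' := repr_smul_apply α h
  by_cases hdT : d ∈ T.diagonals <;> by_cases heT : e ∈ T.diagonals
  · have h1 := h' ⟨d, hdT⟩
    rw [repr_santosVector_of_mem α hdT, repr_santosVector_of_mem α heT] at h1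
    by_contra hne
    simp [Ne.symm hne] at h1
  · have h1 := h' ⟨d, hdT⟩
    rw [repr_santosVector_of_mem α hdT, repr_santosVector_of_not_mem α heT] at h1
    exfalso
    split_ifs at h1 <;> (simp at *; try linarith)
  · have h1 := h' ⟨e, heT⟩
    rw [repr_santosVector_of_mem α heT, repr_santosVector_of_not_mem α hdT] at h1
    exfalso
    split_ifs at h1 <;> (simp at *; try linarith)
  · refine eq_of_crosses_iff hd hdT fun δ hδ => ?_
    have h1 := h' ⟨δ, hδ⟩
    rw [repr_santosVector_of_not_mem α hdT, repr_santosVector_of_not_mem α heT] at h1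
    split_ifs at h1 with h2 h3 h3
    · exact ⟨fun _ => h3, fun _ => h2⟩
    · simp at h1
    · simp [hc.ne] at h1
    · exact ⟨fun h => absurd h h2, fun h => absurd h h3⟩

/-- The vectors of two diagonals point in opposite directions if and only if one of the diagonals
is the flip of the other one. -/
theorem santosVector_opposite_iff {d e : Sym2 (Fin (n + 3))} (hd : IsDiagonal d) :
    (∃ c : ℝ, 0 < c ∧ santosVector T α d = -(c • santosVector T α e)) ↔
      T.IsFlip d e ∨ T.IsFlip e d := by
  -- `v_d` has a single nonzero coordinate, so the 0/1 coordinates of `v_e` say that `e` crosses `d`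
  -- and nothing else in `T`.
  have flip : ∀ {d e : Sym2 (Fin (n + 3))} {c : ℝ}, 0 < c → d ∈ T.diagonals → e ∉ T.diagonals →
      santosVector T α d = (-c) • santosVector T α e → T.IsFlip d e := by
    intro d e c hc hdT heT h
    refine ⟨hdT, fun δ hδ => ?_⟩
    have h1 := repr_smul_apply α h ⟨δ, hδ⟩
    rw [repr_santosVector_of_mem α hdT, repr_santosVector_of_not_mem α heT] at h1
    split_ifs at h1 with h2 h3 h3
    · exact ⟨fun _ => h2.symm, fun _ => h3⟩
    · simp at h1
    · simp [hc.ne'] at h1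
    · exact ⟨fun h => absurd h h3, fun h => absurd h.symm h2⟩
  have opp : ∀ {d e : Sym2 (Fin (n + 3))}, T.IsFlip d e →
      santosVector T α d = -(santosVector T α e) := by
    intro d e h
    apply α.repr.injective
    ext δ
    rw [map_neg, Finsupp.neg_apply, repr_santosVector_of_mem α h.1,
      repr_santosVector_of_not_mem α h.not_mem]
    simp only [h.2 _ δ.2, eq_comm (a := d)]
    split_ifs <;> simp
  constructor
  · rintro ⟨c, hc, h⟩
    rw [← neg_smul] at h
    by_cases hdT : d ∈ T.diagonals <;> by_cases heT : e ∈ T.diagonals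
    · have h1 := repr_smul_apply α h ⟨d, hdT⟩
      rw [repr_santosVector_of_mem α hdT, repr_santosVector_of_mem α heT] at h1
      exfalso
      split_ifs at h1 <;> (simp at *; try linarith)
    · exact Or.inl (flip hc hdT heT h)
    · refine Or.inr (flip (inv_pos.2 hc) heT hdT ?_)
      rw [h, smul_smul, neg_mul_neg, inv_mul_cancel₀ hc.ne', one_smul]
    · obtain ⟨δ, hδ⟩ := exists_repr_santosVector_eq_one α hd hdT
      have h1 := repr_smul_apply α h δ
      rw [hδ, repr_santosVector_of_not_mem α heT] at h1
      exfalso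
      split_ifs at h1 <;> (simp at *; try linarith)
  · rintro (h | h)
    · exact ⟨1, one_pos, by rw [one_smul, opp h]⟩
    · exact ⟨1, one_pos, by rw [one_smul, opp h, neg_neg]⟩

/-- Otherwise `v_e` would be a multiple of `v_d`. A positive factor forces `d = e`, and a negative
one makes them a flip pair, which crosses. This is the hypothesis of
`exists_pos_smul_mem_of_hull_pair_eq`. -/
theorem santosVector_ne_add {d e : Sym2 (Fin (n + 3))} (he : IsDiagonal e)
    (hne : d ≠ e) (hcr : ¬ Crosses d e) {a b : ℝ} (hb : 0 < b) :
    santosVector T α d ≠ a • santosVector T α d + b • santosVector T α e := by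
  intro h
  have h1 : santosVector T α e = ((1 - a) / b) • santosVector T α d := by
    have h2 : b • santosVector T α e = (1 - a) • santosVector T α d := by
      rw [sub_smul, one_smul]
      exact eq_sub_of_add_eq' h.symm
    rw [div_eq_inv_mul, mul_smul, ← h2, smul_smul, inv_mul_cancel₀ hb.ne', one_smul]
  rcases lt_trichotomy ((1 - a) / b) 0 with hc | hc | hc
  · have h2 := (santosVector_opposite_iff α he).1
      ⟨-((1 - a) / b), by linarith, by rw [neg_smul, neg_neg]; exact h1⟩
    rcases h2 with h2 | h2
    · exact hcr h2.crosses
    · exact hcr (crosses_comm.1 h2.crosses)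
  · rw [hc, zero_smul] at h1
    exact santosVector_ne_zero α he h1
  · exact hne (eq_of_santosVector_eq_smul α he hc h1).symm

end Vectors

/-! ### Linear isomorphisms of Santos fans -/

section Cones

variable {V : Type*} [AddCommGroup V] [Module ℝ V]

theorem mem_hull_singleton {u x : V} :
    x ∈ PointedCone.hull ℝ ({u} : Set V) ↔ ∃ a : ℝ, 0 ≤ a ∧ x = a • u := by
  rw [PointedCone.hull, Submodule.mem_span_singleton]
  constructor
  · rintro ⟨a, rfl⟩
    exact ⟨a, a.2, rfl⟩
  · rintro ⟨a, ha, rfl⟩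
    exact ⟨⟨a, ha⟩, rfl⟩

theorem mem_hull_pair {u w x : V} :
    x ∈ PointedCone.hull ℝ ({u, w} : Set V) ↔
      ∃ a b : ℝ, 0 ≤ a ∧ 0 ≤ b ∧ x = a • u + b • w := by
  rw [PointedCone.hull, Submodule.mem_span_pair]
  constructor
  · rintro ⟨a, b, rfl⟩
    exact ⟨a, b, a.2, b.2, rfl⟩
  · rintro ⟨a, b, ha, hb, rfl⟩
    exact ⟨⟨a, ha⟩, ⟨b, hb⟩, rfl⟩

/-- A generating set of a ray contains a vector of this ray. -/
theorem exists_pos_smul_mem_of_hull_singleton_eq {u : V} {G : Set V} (hu : u ≠ 0)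
    (h : PointedCone.hull ℝ ({u} : Set V) = PointedCone.hull ℝ G) :
    ∃ c : ℝ, 0 < c ∧ c • u ∈ G := by
  by_contra! hG
  have h0 : ∀ x ∈ G, x = 0 := by
    intro x hx
    have : x ∈ PointedCone.hull ℝ G := Submodule.subset_span hx
    rw [← h, mem_hull_singleton] at this
    obtain ⟨a, ha, rfl⟩ := this
    rcases ha.eq_or_lt with rfl | ha
    · exact zero_smul _ _
    · exact absurd hx (hG a ha)
  have h1 : u ∈ PointedCone.hull ℝ G := by
    rw [← h]
    exact Submodule.subset_span rfl
  rw [PointedCone.hull, Submodule.span_eq_bot.2 h0] at h1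
  exact hu (by simpa using h1)

/-- A generating set of a pointed two-dimensional cone contains a vector of each boundary ray. -/
theorem exists_pos_smul_mem_of_hull_pair_eq {u w : V} {G : Set V} (hu : u ≠ 0)
    (huw : ∀ a b : ℝ, 0 < b → u ≠ a • u + b • w)
    (h : PointedCone.hull ℝ ({u, w} : Set V) = PointedCone.hull ℝ G) :
    ∃ c : ℝ, 0 < c ∧ c • u ∈ G := by
  by_contra! hG
  -- Zero and the combinations with positive `w`-coefficient are closed under the cone operations.
  -- Without a positive multiple of `u` in `G`, the whole hull would consist of such vectors, yet it
  -- contains `u`.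
  have h0 : ∀ x ∈ PointedCone.hull ℝ G,
      x = 0 ∨ ∃ a b : ℝ, 0 < b ∧ x = a • u + b • w := by
    intro x hx
    induction hx using Submodule.span_induction with
    | mem x hx =>
      have : x ∈ PointedCone.hull ℝ G := Submodule.subset_span hx
      rw [← h, mem_hull_pair] at this
      obtain ⟨a, b, ha, hb, rfl⟩ := this
      rcases hb.eq_or_lt with rfl | hb
      · rcases ha.eq_or_lt with rfl | ha
        · simp
        · exact absurd hx (by simpa using hG a ha)
      · exact Or.inr ⟨a, b, hb, rfl⟩
    | zero => exact Or.inl rfl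
    | add x y _ _ hx hy =>
      rcases hx with rfl | ⟨a, b, hb, rfl⟩
      · simpa using hy
      · rcases hy with rfl | ⟨a', b', hb', rfl⟩
        · exact Or.inr ⟨a, b, hb, by simp⟩
        · exact Or.inr ⟨a + a', b + b', by positivity, by module⟩
    | smul r x _ hx =>
      rcases hx with rfl | ⟨a, b, hb, rfl⟩
      · simp
      · rcases r.2.eq_or_lt with hr | hr
        · left
          have : r = 0 := Subtype.ext hr.symm
          rw [this, zero_smul]
        · right
          refine ⟨r * a, r * b, mul_pos hr hb, ?_⟩
          rw [mul_smul, mul_smul, ← smul_add]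
          rfl
  have h1 : u ∈ PointedCone.hull ℝ G := by
    rw [← h]
    exact Submodule.subset_span (Set.mem_insert _ _)
  rcases h0 u h1 with h1 | ⟨a, b, hb, h1⟩
  · exact hu h1
  · exact huw a b hb h1

end Cones

section Isomorphism

variable {V V' : Type*} [AddCommGroup V] [Module ℝ V] [AddCommGroup V'] [Module ℝ V']

theorem map_hull (L : V →ₗ[ℝ] V') (G : Set V) :
    PointedCone.map L (PointedCone.hull ℝ G) = PointedCone.hull ℝ (L '' G) :=
  Submodule.map_span _ _

theorem LinearlyIsomorphic.symm_image {F : Set (PointedCone ℝ V)} {F' : Set (PointedCone ℝ V')}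
    {L : V ≃ₗ[ℝ] V'} (h : (fun C => PointedCone.map (L : V →ₗ[ℝ] V') C) '' F = F') :
    (fun C => PointedCone.map (L.symm : V' →ₗ[ℝ] V) C) '' F' = F := by
  rw [← h, Set.image_image]
  convert Set.image_id F using 2
  ext C
  simp [PointedCone.mem_map]

variable {T₁ T₂ : Triangulation n} {α₁ : Module.Basis T₁.diagonals ℝ V}
  {α₂ : Module.Basis T₂.diagonals ℝ V'} {L : V ≃ₗ[ℝ] V'}

/-- The cone of `d` and `e` maps to the cone of a non-crossing set, whose generators must include
its extreme rays. The case `d = e` is allowed and yields the map on single diagonals. -/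
theorem exists_noncrossing_images
    (h : (fun C => PointedCone.map (L : V →ₗ[ℝ] V') C) '' santosFan T₁ α₁ = santosFan T₂ α₂)
    {d e : Sym2 (Fin (n + 3))} (hd : IsDiagonal d) (he : IsDiagonal e) (hde : ¬ Crosses d e) :
    ∃ d' e', IsDiagonal d' ∧ IsDiagonal e' ∧ ¬ Crosses d' e' ∧
      (∃ c : ℝ, 0 < c ∧ c • L (santosVector T₁ α₁ d) = santosVector T₂ α₂ d') ∧
      ∃ c : ℝ, 0 < c ∧ c • L (santosVector T₁ α₁ e) = santosVector T₂ α₂ e' := by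
  classical
  have h1 : IsNonCrossing {d, e} := by
    constructor
    · intro x hx
      rw [Finset.mem_insert, Finset.mem_singleton] at hx
      rcases hx with rfl | rfl <;> assumption
    · intro x hx y hy
      rw [Finset.mem_insert, Finset.mem_singleton] at hx hy
      rcases hx with rfl | rfl <;> rcases hy with rfl | rfl
      · exact not_crosses_self _
      · exact hde
      · exact fun h => hde (crosses_comm.1 h)
      · exact not_crosses_self _
  have h2 : PointedCone.map (L : V →ₗ[ℝ] V') (santosCone T₁ α₁ {d, e}) ∈ santosFan T₂ α₂ := by
    rw [← h]
    exact ⟨_, ⟨_, h1, rfl⟩, rfl⟩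
  obtain ⟨S, hS, h3⟩ := h2
  rw [santosCone, santosCone, map_hull] at h3
  simp only [Finset.coe_insert, Finset.coe_singleton, Set.image_pair, LinearEquiv.coe_coe] at h3
  have hne : ∀ d, IsDiagonal d → L (santosVector T₁ α₁ d) ≠ 0 := fun d hd =>
    L.map_ne_zero_iff.2 (santosVector_ne_zero α₁ hd)
  have hadd : ∀ d e, IsDiagonal e → d ≠ e → ¬ Crosses d e → ∀ a b : ℝ, 0 < b →
      L (santosVector T₁ α₁ d) ≠
        a • L (santosVector T₁ α₁ d) + b • L (santosVector T₁ α₁ e) := by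
    intro d e he hne hcr a b hb h
    rw [← map_smul, ← map_smul, ← map_add] at h
    exact santosVector_ne_add α₁ he hne hcr hb (L.injective h)
  have main : (∃ c : ℝ, 0 < c ∧ c • L (santosVector T₁ α₁ d) ∈
        santosVector T₂ α₂ '' (S : Set (Sym2 (Fin (n + 3))))) ∧
      ∃ c : ℝ, 0 < c ∧ c • L (santosVector T₁ α₁ e) ∈
        santosVector T₂ α₂ '' (S : Set (Sym2 (Fin (n + 3)))) := by
    by_cases hde' : d = e
    · subst hde'
      rw [Set.pair_eq_singleton] at h3
      have := exists_pos_smul_mem_of_hull_singleton_eq (hne d hd) h3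
      exact ⟨this, this⟩
    · refine ⟨exists_pos_smul_mem_of_hull_pair_eq (hne d hd) (hadd d e he hde' hde) h3, ?_⟩
      rw [Set.pair_comm] at h3
      exact exists_pos_smul_mem_of_hull_pair_eq (hne e he)
        (hadd e d hd (Ne.symm hde') fun h => hde (crosses_comm.1 h)) h3
  obtain ⟨⟨c, hc, d', hd', h4⟩, c', hc', e', he', h5⟩ := main
  exact ⟨d', e', hS.1 _ hd', hS.1 _ he', hS.2 _ hd' _ he', ⟨c, hc, h4.symm⟩, c', hc', h5.symm⟩

end Isomorphism

end Associahedron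

namespace Associahedron

/-! ### The fan determines the seed up to symmetry -/

section Final

open Triangulation

variable {n : ℕ} {V V' : Type*} [AddCommGroup V] [Module ℝ V] [AddCommGroup V'] [Module ℝ V']
  {T₁ T₂ : Triangulation n} (α₁ : Module.Basis T₁.diagonals ℝ V)
  (α₂ : Module.Basis T₂.diagonals ℝ V')

theorem santosVector_map {φ : Fin (n + 3) → Fin (n + 3)} (hφ : IsRotationOrReflection φ)
    (h : ∀ d, d.map φ ∈ T₂.diagonals ↔ d ∈ T₁.diagonals) :
    ∃ L : V ≃ₗ[ℝ] V', ∀ d, L (santosVector T₁ α₁ d) = santosVector T₂ α₂ (d.map φ) := by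
  let ψ : T₁.diagonals ≃ T₂.diagonals :=
    (Equiv.ofBijective _ hφ.map_bijective).subtypeEquiv fun d => (h d).symm
  have hψ : ∀ δ, (ψ δ : Sym2 (Fin (n + 3))) = (δ : Sym2 (Fin (n + 3))).map φ := fun δ => rfl
  refine ⟨α₁.equiv α₂ ψ, fun d => ?_⟩
  by_cases hd : d ∈ T₁.diagonals
  · rw [santosVector, santosVector, dif_pos hd, dif_pos ((h d).2 hd), map_neg,
      Module.Basis.equiv_apply]
    rfl
  · rw [santosVector, santosVector, dif_neg hd, dif_neg (fun h' => hd ((h d).1 h')), map_sum,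
      ← ψ.sum_comp]
    refine Finset.sum_congr rfl fun δ _ => ?_
    simp only [hψ, hφ.crosses_iff]
    split_ifs
    · rw [Module.Basis.equiv_apply]
    · rw [map_zero]

theorem linearlyIsomorphic_of_equivalent (h : RotationReflectionEquivalent T₁ T₂) :
    LinearlyIsomorphic (santosFan T₁ α₁) (santosFan T₂ α₂) := by
  obtain ⟨φ, hφ, himg⟩ := h
  have hmem : ∀ d, d.map φ ∈ T₂.diagonals ↔ d ∈ T₁.diagonals := by
    intro d
    rw [← himg, Finset.mem_image]
    constructor
    · rintro ⟨e, he, hed⟩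
      exact hφ.map_bijective.1 hed ▸ he
    · exact fun hd => ⟨d, hd, rfl⟩
  obtain ⟨L, hL⟩ := santosVector_map α₁ α₂ hφ hmem
  have hcone : ∀ S, PointedCone.map (L : V →ₗ[ℝ] V') (santosCone T₁ α₁ S) =
      santosCone T₂ α₂ (S.image (Sym2.map φ)) := by
    intro S
    rw [santosCone, santosCone, map_hull, Finset.coe_image, Set.image_image, Set.image_image]
    simp only [LinearEquiv.coe_coe, hL]
  refine ⟨L, ?_⟩
  ext C
  constructor
  · rintro ⟨_, ⟨S, hS, rfl⟩, rfl⟩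
    exact ⟨_, (hφ.isNonCrossing_image S).2 hS, hcone S⟩
  · rintro ⟨S', hS', rfl⟩
    obtain ⟨S, rfl⟩ : ∃ S : Finset (Sym2 (Fin (n + 3))), S.image (Sym2.map φ) = S' :=
      ⟨S'.image (Function.surjInv hφ.map_bijective.2), by
        rw [Finset.image_image, (Function.rightInverse_surjInv _).comp_eq_id, Finset.image_id]⟩
    exact ⟨_, ⟨S, (hφ.isNonCrossing_image S).1 hS', rfl⟩, hcone S⟩

theorem equivalent_of_quadrilateral (T₁ T₂ : Triangulation 1) :
    RotationReflectionEquivalent T₁ T₂ := by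
  have hd : ∀ d : Sym2 (Fin (1 + 3)), IsDiagonal d → d = s(0, 2) ∨ d = s(1, 3) := by decide
  have hc : ∀ d : Sym2 (Fin (1 + 3)), Crosses s(0, 2) d ↔ d = s(1, 3) := by decide
  have hT : ∀ T : Triangulation 1, T.diagonals = {s(0, 2)} ∨ T.diagonals = {s(1, 3)} := by
    intro T
    by_cases h : s(0, 2) ∈ T.diagonals
    · left
      refine Finset.eq_singleton_iff_unique_mem.2 ⟨h, fun d hdT => ?_⟩
      exact (hd d (isDiagonal hdT)).resolve_right fun h' => not_crosses h hdT ((hc d).2 h')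
    · right
      obtain ⟨e, he, hce⟩ := exists_crosses_of_not_mem (by decide) h
      obtain rfl := (hc e).1 hce
      refine Finset.eq_singleton_iff_unique_mem.2 ⟨he, fun d hdT => ?_⟩
      exact (hd d (isDiagonal hdT)).resolve_left fun h' => h (h' ▸ hdT)
  have h0 : IsRotationOrReflection fun i : Fin (1 + 3) => 0 + i := Or.inl ⟨0, fun _ => rfl⟩
  have h1 : IsRotationOrReflection fun i : Fin (1 + 3) => 1 + i := Or.inl ⟨1, fun _ => rfl⟩
  rcases hT T₁ with e₁ | e₁ <;> rcases hT T₂ with e₂ | e₂ <;>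
    rw [RotationReflectionEquivalent, e₁, e₂]
  · exact ⟨_, h0, by decide⟩
  · exact ⟨_, h1, by decide⟩
  · exact ⟨_, h1, by decide⟩
  · exact ⟨_, h0, by decide⟩

/-- The recovery of the seed breaks down in the square, where each diagonal is the flip of the
other; but a rotation by one vertex exchanges its two triangulations. -/
theorem equivalent_of_lt_two (hn : n < 2) (T₁ T₂ : Triangulation n) :
    RotationReflectionEquivalent T₁ T₂ := by
  obtain rfl | rfl : n = 0 ∨ n = 1 := by omega
  · have h0 : ∀ T : Triangulation 0, T.diagonals = ∅ := by
      intro T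
      refine Finset.eq_empty_of_forall_notMem fun d hd => ?_
      have : ∀ d : Sym2 (Fin (0 + 3)), ¬ IsDiagonal d := by decide
      exact this d (isDiagonal hd)
    exact ⟨fun i => 0 + i, Or.inl ⟨0, fun _ => rfl⟩, by rw [h0, h0, Finset.image_empty]⟩
  · exact equivalent_of_quadrilateral T₁ T₂

theorem equivalent_of_linearlyIsomorphic (hn : 2 ≤ n)
    (h : LinearlyIsomorphic (santosFan T₁ α₁) (santosFan T₂ α₂)) :
    RotationReflectionEquivalent T₁ T₂ := by
  classical
  obtain ⟨L, hL⟩ := h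
  have himg := fun d e hd he hde => exists_noncrossing_images hL (d := d) (e := e) hd he hde
  have himg' := fun d e hd he hde =>
    exists_noncrossing_images (LinearlyIsomorphic.symm_image hL) (d := d) (e := e) hd he hde
  have hf : ∀ d, ∃ d', IsDiagonal d → IsDiagonal d' ∧
      ∃ c : ℝ, 0 < c ∧ c • L (santosVector T₁ α₁ d) = santosVector T₂ α₂ d' := by
    intro d
    by_cases hd : IsDiagonal d
    · obtain ⟨d', _, h1, _, _, h2, _⟩ := himg d d hd hd (not_crosses_self d)
      exact ⟨d', fun _ => ⟨h1, h2⟩⟩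
    · exact ⟨d, fun h => absurd h hd⟩
  have hg : ∀ d, ∃ d', IsDiagonal d → IsDiagonal d' ∧
      ∃ c : ℝ, 0 < c ∧ c • L.symm (santosVector T₂ α₂ d) = santosVector T₁ α₁ d' := by
    intro d
    by_cases hd : IsDiagonal d
    · obtain ⟨d', _, h1, _, _, h2, _⟩ := himg' d d hd hd (not_crosses_self d)
      exact ⟨d', fun _ => ⟨h1, h2⟩⟩
    · exact ⟨d, fun h => absurd h hd⟩
  choose f hf using hf
  choose g hg using hg
  -- Distinct diagonals span distinct rays, so any image diagonal supplied by `himg` is the chosen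
  -- `f d`; this makes `f` and `g` mutually inverse.
  have funiq : ∀ {d d'}, IsDiagonal d → IsDiagonal d' → ∀ {c : ℝ}, 0 < c →
      c • L (santosVector T₁ α₁ d) = santosVector T₂ α₂ d' → d' = f d := by
    intro d d' hd hd' c hc h
    obtain ⟨_, b, hb, h'⟩ := hf d hd
    refine eq_of_santosVector_eq_smul α₂ hd' (c := c * b⁻¹) (by positivity) ?_
    rw [← h, ← h', smul_smul, mul_assoc, inv_mul_cancel₀ hb.ne', mul_one]
  have guniq : ∀ {d d'}, IsDiagonal d → IsDiagonal d' → ∀ {c : ℝ}, 0 < c →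
      c • L.symm (santosVector T₂ α₂ d) = santosVector T₁ α₁ d' → d' = g d := by
    intro d d' hd hd' c hc h
    obtain ⟨_, b, hb, h'⟩ := hg d hd
    refine eq_of_santosVector_eq_smul α₁ hd' (c := c * b⁻¹) (by positivity) ?_
    rw [← h, ← h', smul_smul, mul_assoc, inv_mul_cancel₀ hb.ne', mul_one]
  have hgf : ∀ d, IsDiagonal d → g (f d) = d := by
    intro d hd
    obtain ⟨h1, c, hc, h2⟩ := hf d hd
    refine (guniq h1 hd (inv_pos.2 hc) ?_).symm
    rw [← h2, map_smul, L.symm_apply_apply, smul_smul, inv_mul_cancel₀ hc.ne', one_smul]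
  have hfg : ∀ d, IsDiagonal d → f (g d) = d := by
    intro d hd
    obtain ⟨h1, c, hc, h2⟩ := hg d hd
    refine (funiq h1 hd (inv_pos.2 hc) ?_).symm
    rw [← h2, map_smul, L.apply_symm_apply, smul_smul, inv_mul_cancel₀ hc.ne', one_smul]
  have hc : ∀ d e, IsDiagonal d → IsDiagonal e → (Crosses (f d) (f e) ↔ Crosses d e) := by
    intro d e hd he
    constructor
    · contrapose
      intro h
      obtain ⟨d', e', h1, h2, h3, ⟨c, hc, h4⟩, c', hc', h5⟩ := himg d e hd he h
      rwa [← funiq hd h1 hc h4, ← funiq he h2 hc' h5]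
    · contrapose
      intro h
      obtain ⟨d', e', h1, h2, h3, ⟨c, hc, h4⟩, c', hc', h5⟩ :=
        himg' (f d) (f e) (hf d hd).1 (hf e he).1 h
      have e1 := guniq (hf d hd).1 h1 hc h4
      have e2 := guniq (hf e he).1 h2 hc' h5
      rw [hgf d hd] at e1
      rw [hgf e he] at e2
      rwa [← e1, ← e2]
  have hflip : ∀ d e, IsDiagonal d → IsDiagonal e →
      ((T₂.IsFlip (f d) (f e) ∨ T₂.IsFlip (f e) (f d)) ↔ (T₁.IsFlip d e ∨ T₁.IsFlip e d)) := by
    intro d e hd he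
    obtain ⟨hd', a, ha, h1⟩ := hf d hd
    obtain ⟨he', b, hb, h2⟩ := hf e he
    rw [← santosVector_opposite_iff α₁ hd, ← santosVector_opposite_iff α₂ hd', ← h1, ← h2]
    constructor
    · rintro ⟨c, hc, h3⟩
      refine ⟨a⁻¹ * (c * b), by positivity, L.injective ?_⟩
      rw [map_neg, map_smul, mul_smul, mul_smul, ← smul_neg, ← h3, smul_smul,
        inv_mul_cancel₀ ha.ne', one_smul]
    · rintro ⟨c, hc, h3⟩
      refine ⟨a * c * b⁻¹, by positivity, ?_⟩
      rw [h3, map_neg, map_smul, smul_neg, smul_smul, smul_smul, mul_assoc (a * c),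
        inv_mul_cancel₀ hb.ne', mul_one]
  -- The criterion of `mem_diagonals_iff` mentions only flip pairs and crossings, and `f` preserves
  -- both.
  have hmem : ∀ d, IsDiagonal d → (f d ∈ T₂.diagonals ↔ d ∈ T₁.diagonals) := by
    intro d hd
    rw [mem_diagonals_iff hn, mem_diagonals_iff hn]
    have diag : ∀ {T : Triangulation n} {x y}, (T.IsFlip x y ∨ T.IsFlip y x) →
        IsDiagonal x ∧ IsDiagonal y := by
      rintro T x y (h | h)
      · exact h.isDiagonal
      · exact h.isDiagonal.symm
    constructor
    · rintro ⟨e, he, h⟩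
      have hed := (diag he).2
      rw [← hfg e hed, hflip _ _ hd (hg e hed).1] at he
      refine ⟨g e, he, fun x y hxy hx => ?_⟩
      obtain ⟨hxd, hyd⟩ := diag hxy
      rw [← h (f x) (f y) ((hflip x y hxd hyd).2 hxy) ((hc d x hd hxd).2 hx), hgf x hxd]
    · rintro ⟨e, he, h⟩
      have hed := (diag he).2
      refine ⟨f e, (hflip d e hd hed).2 he, fun x y hxy hx => ?_⟩
      obtain ⟨hxd, hyd⟩ := diag hxy
      rw [← hfg x hxd, ← hfg y hyd, hflip _ _ (hg x hxd).1 (hg y hyd).1] at hxy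
      rw [← hfg x hxd, hc d _ hd (hg x hxd).1] at hx
      rw [← h _ _ hxy hx, hfg x hxd]
  obtain ⟨φ, hφ, hφf⟩ := exists_isRotationOrReflection hn (fun d hd => (hf d hd).1)
    (fun d hd => (hg d hd).1) hgf hfg hc
  refine ⟨φ, hφ, ?_⟩
  ext e
  rw [Finset.mem_image]
  constructor
  · rintro ⟨d, hd, rfl⟩
    have hdd := isDiagonal hd
    rw [← hφf d hdd]
    exact (hmem d hdd).2 hd
  · intro he
    have hed := isDiagonal he
    refine ⟨g e, ?_, ?_⟩
    · rw [← hmem _ (hg e hed).1, hfg e hed]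
      exact he
    · rw [← hφf _ (hg e hed).1, hfg e hed]

theorem linearlyIsomorphic_santosFan_iff :
    LinearlyIsomorphic (santosFan T₁ α₁) (santosFan T₂ α₂) ↔
      RotationReflectionEquivalent T₁ T₂ := by
  refine ⟨fun h => ?_, linearlyIsomorphic_of_equivalent α₁ α₂⟩
  rcases lt_or_ge n 2 with hn | hn
  · exact equivalent_of_lt_two hn T₁ T₂
  · exact equivalent_of_linearlyIsomorphic α₁ α₂ hn h

end Final

end Associahedron

theorem mainTheorem3 (n : ℕ) (T₁ T₂ : Associahedron.Triangulation n)
    {V₁ V₂ : Type*} [AddCommGroup V₁] [Module ℝ V₁] [AddCommGroup V₂] [Module ℝ V₂]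
    (α₁ : Module.Basis T₁.diagonals ℝ V₁) (α₂ : Module.Basis T₂.diagonals ℝ V₂)
    {W₁ W₂ : Type*} [AddCommGroup W₁] [Module ℝ W₁] [AddCommGroup W₂] [Module ℝ W₂] :
    (Associahedron.LinearlyIsomorphic (Associahedron.santosFan T₁ α₁)
        (Associahedron.santosFan T₂ α₂) ↔
      Associahedron.RotationReflectionEquivalent T₁ T₂) ∧
    ∀ (P₁ : Set W₁) (P₂ : Set W₂),
      Associahedron.IsSantosAssociahedron T₁ P₁ → Associahedron.IsSantosAssociahedron T₂ P₂ →
      (Associahedron.NormallyIsomorphic P₁ P₂ ↔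
        Associahedron.RotationReflectionEquivalent T₁ T₂) := by
  refine ⟨Associahedron.linearlyIsomorphic_santosFan_iff α₁ α₂, ?_⟩
  rintro P₁ P₂ ⟨-, β₁, h₁⟩ ⟨-, β₂, h₂⟩
  -- The polytopes come with their own bases `β₁`, `β₂` of the dual spaces; the statement on fans
  -- holds for every choice of bases.
  rw [Associahedron.NormallyIsomorphic, h₁, h₂]
  exact Associahedron.linearlyIsomorphic_santosFan_iff β₁ β₂
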